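/- For a finite nonempty simple graph $G$ let $\mathrm{tw}(G)$ be its tree-width and $\mathrm{cw}(G)$ its clique-width. The multi-clique-width $\mathrm{mcw}(G)$ is the least $k$ such that $G$ is generated, up to isomorphism, by a multi-$k$-expression: an expression that builds a graph whose vertices carry arbitrary (possibly empty) subsets of $\{1,\dots,k\}$ as label sets, by means of the operations (i) create $m\ge 1$ isolated vertices, all with the same label set; (ii) disjoint union; (iii) join all vertices having label $i$ to all vertices having label $j$, allowed only if $i\ne j$ and no vertex has both labels; (iv) replace the label $i$ by a set of labels $S$ in every label set that contains $i$; (v) delete the label $i$ everywhere. There is a constant $c>0$ such that for every integer $k\ge 0$ and all sufficiently large $n$ (depending on $k$) there is a graph $G$ with $n$ vertices such that $$\mathrm{tw}(G)\ \ge\ c\,n,\qquad \mathrm{mcw}(G)\ \le\ k+2,\qquad \mathrm{cw}(G)\ \ge\ 2^{\lfloor k/2\rfloor-1}.$$ Thus clique-width can be exponentially larger than multi-clique-width even for graphs of tree-width $\Omega(n)$. -/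

import Mathlib

/-- A tree decomposition of `G` with index set `I`: a tree on `I` and a bag for every node. -/
structure TreeDecomposition {V : Type*} (G : SimpleGraph V) (I : Type*) where
  /-- the tree -/
  tree : SimpleGraph I
  isTree : tree.IsTree
  /-- the bags -/
  bag : I → Finset V
  /-- every vertex belongs to at least one bag -/
  exists_mem_bag : ∀ v : V, ∃ i : I, v ∈ bag i
  /-- every edge is contained in at least one bag -/
  exists_edge_bag : ∀ p q : V, G.Adj p q → ∃ i : I, p ∈ bag i ∧ q ∈ bag i
  /-- the nodes whose bags contain a given vertex induce a connected subgraph of the tree -/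
  connected_nodes : ∀ v : V, (tree.induce {i : I | v ∈ bag i}).Connected

/-- The width of a tree decomposition: one less than the largest bag size. -/
def TreeDecomposition.width {V : Type*} {G : SimpleGraph V} {I : Type*} [Fintype I]
    (D : TreeDecomposition G I) : ℕ :=
  (Finset.univ.sup fun i : I => (D.bag i).card) - 1

/-- The tree-width of a finite nonempty graph: the least width of a tree decomposition
(every finite tree is, up to renaming its nodes, a tree on some `Fin m`). -/
noncomputable def treeWidth {V : Type*} (G : SimpleGraph V) : ℕ :=
  sInf {w : ℕ | ∃ (m : ℕ) (D : TreeDecomposition G (Fin m)), D.width = w}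

/-- The `k`-expressions. The label set `{1, …, k}` is represented by `Fin k`; the names of the
vertices are left out, since an expression is evaluated up to isomorphism. -/
inductive CWExpr (k : ℕ) : Type
  /-- create a vertex with label `i` -/
  | vertex (i : Fin k) : CWExpr k
  /-- join every vertex with label `i` to every vertex with label `j`, where `i ≠ j` -/
  | eta (i j : Fin k) (hij : i ≠ j) (e : CWExpr k) : CWExpr k
  /-- change all labels `i` to `j` -/
  | rho (i j : Fin k) (e : CWExpr k) : CWExpr k
  /-- disjoint union -/
  | join (a b : CWExpr k) : CWExpr k

namespace CWExpr

/-- The vertices created by a `k`-expression. -/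
def Vert {k : ℕ} : CWExpr k → Type
  | vertex _ => Unit
  | eta _ _ _ e => e.Vert
  | rho _ _ e => e.Vert
  | join a b => a.Vert ⊕ b.Vert

/-- The label of each vertex of the labeled graph generated by a `k`-expression. -/
def label {k : ℕ} : (e : CWExpr k) → e.Vert → Fin k
  | vertex i => fun _ => i
  | eta _ _ _ e => e.label
  | rho i j e => fun v => if e.label v = i then j else e.label v
  | join a b => Sum.elim a.label b.label

/-- The graph generated by a `k`-expression. -/
def graph {k : ℕ} : (e : CWExpr k) → SimpleGraph e.Vert
  | vertex _ => ⊥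
  | eta i j _ e => e.graph ⊔ SimpleGraph.fromRel fun u v => e.label u = i ∧ e.label v = j
  | rho _ _ e => e.graph
  | join a b => SimpleGraph.sum a.graph b.graph

end CWExpr

/-- The clique-width of a finite nonempty graph: the least `k` such that the graph is generated by a
`k`-expression. -/
noncomputable def cliqueWidth {V : Type*} (G : SimpleGraph V) : ℕ :=
  sInf {k : ℕ | ∃ e : CWExpr k, Nonempty (e.graph ≃g G)}

/-- The syntax of multi-`k`-expressions. The label set `{1, …, k}` is represented by `Fin k`.
The side condition on `eta` is `MultiExpr.Valid` below. -/
inductive MultiExpr (k : ℕ) : Type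
  /-- create `m ≥ 1` vertices, each with label set `S` -/
  | atom (m : ℕ) (hm : 0 < m) (S : Finset (Fin k)) : MultiExpr k
  /-- join every vertex that has label `i` to every vertex that has label `j` -/
  | eta (i j : Fin k) (e : MultiExpr k) : MultiExpr k
  /-- replace the label `i` by the set of labels `S` -/
  | rho (i : Fin k) (S : Finset (Fin k)) (e : MultiExpr k) : MultiExpr k
  /-- delete the label `i` from all vertices -/
  | eps (i : Fin k) (e : MultiExpr k) : MultiExpr k
  /-- disjoint union -/
  | join (a b : MultiExpr k) : MultiExpr k

namespace MultiExpr

/-- The vertices created by a multi-`k`-expression. -/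
def Vert {k : ℕ} : MultiExpr k → Type
  | atom m _ _ => Fin m
  | eta _ _ e => e.Vert
  | rho _ _ e => e.Vert
  | eps _ e => e.Vert
  | join a b => a.Vert ⊕ b.Vert

/-- The label set of each vertex of the labeled graph generated by a multi-`k`-expression. -/
def labels {k : ℕ} : (e : MultiExpr k) → e.Vert → Finset (Fin k)
  | atom _ _ S => fun _ => S
  | eta _ _ e => e.labels
  | rho i S e => fun v => if i ∈ e.labels v then (e.labels v).erase i ∪ S else e.labels v
  | eps i e => fun v => (e.labels v).erase i
  | join a b => Sum.elim a.labels b.labels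

/-- The operation `eta i j` is only allowed when `i ≠ j` and no vertex has the labels `i` and `j`
simultaneously; a multi-`k`-expression is an expression all of whose operations are allowed. -/
def Valid {k : ℕ} : MultiExpr k → Prop
  | atom _ _ _ => True
  | eta i j e => e.Valid ∧ i ≠ j ∧ ∀ v : e.Vert, ¬ (i ∈ e.labels v ∧ j ∈ e.labels v)
  | rho _ _ e => e.Valid
  | eps _ e => e.Valid
  | join a b => a.Valid ∧ b.Valid

/-- The graph generated by a multi-`k`-expression. -/
def graph {k : ℕ} : (e : MultiExpr k) → SimpleGraph e.Vert
  | atom _ _ _ => ⊥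
  | eta i j e => e.graph ⊔ SimpleGraph.fromRel fun u v => i ∈ e.labels u ∧ j ∈ e.labels v
  | rho _ _ e => e.graph
  | eps _ e => e.graph
  | join a b => SimpleGraph.sum a.graph b.graph

end MultiExpr

/-- The multi-clique-width of a finite nonempty graph: the least `k` such that the graph is generated
by a multi-`k`-expression. -/
noncomputable def multiCliqueWidth {V : Type*} (G : SimpleGraph V) : ℕ :=
  sInf {k : ℕ | ∃ e : MultiExpr k, e.Valid ∧ Nonempty (e.graph ≃g G)}

/-!
The graph is a *hub graph*. Every vertex carries a pair `(i, S)`, a hub `i` out of `m + 1` hubs and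
a set `S` of hubs, where `m = k / 2`, and two distinct vertices are adjacent if the hub of one
belongs to the set of the other (`hubGraph`). All pairs occur, and the pair `(0, {0})` occurs on all
but boundedly many of the `n` vertices.

* Tree-width: the vertices with the pair `(0, {0})` form a clique, and a clique is contained in a
  bag of every tree decomposition (`TreeDecomposition.exists_bag_of_isClique`).
* Multi-clique-width: the vertices are added one at a time. An old vertex shows its set `S` by
  `m + 1` labels and its hub by one further label, and one label marks the vertex that is being
  added. In a suitable order the hub `0` needs no label of the second kind, so that `2 * m + 2`
  labels suffice (`multiCliqueWidth_hubGraph_le`).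
* Clique-width: let `A` be the vertex set of a subexpression of an `r`-expression. Vertices of `A`
  with the same label have the same neighbors outside `A`. Call `A` rich if for some hub `i` it
  contains the pairs `(i, S)` for at least half of all `S`. If `A` is not rich, then for all hubs
  `i` and `j` some vertex outside `A` has hub `j` and a set avoiding `i`; it is adjacent to `(i, S)`
  exactly if `j ∈ S`. So the vertices `(i, S)` in `A` have different labels
  (`ncard_le_of_not_isRich`). A minimal rich subexpression is a disjoint union of two that are not
  rich (`CWExpr.Occurs.exists_cut`), and one of these contains `(i, S)` for at least a quarter of
  all `S`. Hence `r ≥ 2 ^ (m - 1)`.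

The widths are infima of sets of natural numbers, which are `0` for the empty set, so the lower
bounds also use a tree decomposition and an expression for the graph
(`TreeDecomposition.trivial`, `exists_cwExpr`).
-/

/-! ### Tree-width and cliques -/

/-- A connected set of nodes of a tree has a gate towards every node `i`: its point `z` nearest to
`i` lies in every connected set that contains `i` and meets the given set. -/
lemma SimpleGraph.IsTree.exists_gate {I : Type*} {T : SimpleGraph I} (hT : T.IsTree) {S : Set I}
    (hS : (T.induce S).Connected) (i : I) :
    ∃ z ∈ S, ∀ U : Set I, (T.induce U).Connected → i ∈ U → (U ∩ S).Nonempty → z ∈ U := by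
  classical
  obtain ⟨⟨z₀, hz₀⟩⟩ := hS.nonempty
  obtain ⟨z, hz, hmin⟩ : ∃ z ∈ S, ∀ y ∈ S, T.dist z i ≤ T.dist y i := by
    obtain ⟨z, hz, h⟩ := (measure fun z => T.dist z i).wf.has_min S ⟨z₀, hz₀⟩
    exact ⟨z, hz, fun y hy => not_lt.1 (h y hy)⟩
  refine ⟨z, hz, ?_⟩
  rintro U hU hiU ⟨x, hxU, hxS⟩
  obtain ⟨p, hp⟩ := hS.exists_isPath ⟨x, hxS⟩ ⟨z, hz⟩
  obtain ⟨r, hr⟩ := hU.exists_isPath ⟨x, hxU⟩ ⟨i, hiU⟩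
  obtain ⟨q, hq⟩ := hT.1.exists_walk_length_eq_dist z i
  have hqp : q.IsPath := q.isPath_of_length_eq_dist hq
  let p' : T.Walk x z := p.map (SimpleGraph.Embedding.induce S).toHom
  let r' : T.Walk x i := r.map (SimpleGraph.Embedding.induce U).toHom
  have hp' : p'.IsPath :=
    hp.map (SimpleGraph.Embedding.induce (G := T) S).injective
  have hr' : r'.IsPath :=
    hr.map (SimpleGraph.Embedding.induce (G := T) U).injective
  -- beyond its first node, the shortest walk from `z` to `i` avoids `S`
  have hqS : ∀ y ∈ q.support, y ∈ S → y = z := by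
    intro y hy hyS
    have h1 := congrArg SimpleGraph.Walk.length (q.take_spec hy)
    rw [SimpleGraph.Walk.length_append] at h1
    have h2 := T.dist_le (q.dropUntil y hy)
    have h3 := hmin y hyS
    exact (SimpleGraph.Walk.eq_of_length_eq_zero (p := q.takeUntil y hy) (by omega)).symm
  have hpS : ∀ y ∈ p'.support, y ∈ S := by
    intro y hy
    have hsupp : p'.support = p.support.map Subtype.val := p.support_map _
    rw [hsupp, List.mem_map] at hy
    obtain ⟨w, _, rfl⟩ := hy
    exact w.2
  have hpq : (p'.append q).IsPath := by
    rw [SimpleGraph.Walk.isPath_def, SimpleGraph.Walk.support_append, List.nodup_append']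
    refine ⟨hp'.support_nodup, hqp.support_nodup.tail, ?_⟩
    intro y hy1 hy2
    have hyz := hqS y (List.mem_of_mem_tail hy2) (hpS y hy1)
    have := hqp.support_nodup
    rw [← SimpleGraph.Walk.cons_tail_support] at this
    exact (List.nodup_cons.1 this).1 (hyz ▸ hy2)
  have heq : p'.append q = r' := (hT.existsUnique_path x i).unique hpq hr'
  have hzr : z ∈ r'.support := by
    rw [← heq, SimpleGraph.Walk.mem_support_append_iff]
    exact Or.inl p'.end_mem_support
  have hsupp : r'.support = r.support.map Subtype.val := r.support_map _
  rw [hsupp, List.mem_map] at hzr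
  obtain ⟨w, _, hw⟩ := hzr
  exact hw ▸ w.2

/-- Every clique is contained in a bag. -/
lemma TreeDecomposition.exists_bag_of_isClique {V I : Type*} {G : SimpleGraph V}
    (D : TreeDecomposition G I) {K : Finset V} (hK : G.IsClique (K : Set V)) :
    ∃ i, K ⊆ D.bag i := by
  classical
  have := D.isTree.1.nonempty
  -- choose a bag containing as much of `K` as possible
  obtain ⟨i, hi⟩ : ∃ i, ∀ j, (K ∩ D.bag j).card ≤ (K ∩ D.bag i).card := by
    have hb : BddAbove (Set.range fun j => (K ∩ D.bag j).card) :=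
      ⟨K.card, by rintro _ ⟨j, rfl⟩; exact Finset.card_le_card Finset.inter_subset_left⟩
    obtain ⟨i, hi⟩ := Nat.sSup_mem (Set.range_nonempty _) hb
    exact ⟨i, fun j => (le_csSup hb ⟨j, rfl⟩).trans_eq hi.symm⟩
  refine ⟨i, fun v hvK => by_contra fun hvi => ?_⟩
  obtain ⟨z, hz, hgate⟩ := D.isTree.exists_gate (D.connected_nodes v) i
  have hsub : insert v (K ∩ D.bag i) ⊆ K ∩ D.bag z := by
    intro u hu
    rcases Finset.mem_insert.1 hu with rfl | hu
    · exact Finset.mem_inter.2 ⟨hvK, hz⟩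
    obtain ⟨huK, hui⟩ := Finset.mem_inter.1 hu
    have huv : u ≠ v := by rintro rfl; exact hvi hui
    obtain ⟨x, hxu, hxv⟩ := D.exists_edge_bag u v (hK huK hvK huv)
    exact Finset.mem_inter.2 ⟨huK, hgate _ (D.connected_nodes u) hui ⟨x, hxu, hxv⟩⟩
  have h1 := Finset.card_le_card hsub
  rw [Finset.card_insert_of_notMem (fun h => hvi (Finset.mem_inter.1 h).2)] at h1
  have h2 := hi z
  omega

/-- The tree decomposition with a single bag. -/
def TreeDecomposition.trivial {V : Type*} [Fintype V] (G : SimpleGraph V) :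
    TreeDecomposition G (Fin 1) where
  tree := ⊥
  isTree := SimpleGraph.IsTree.of_subsingleton
  bag _ := Finset.univ
  exists_mem_bag v := ⟨0, Finset.mem_univ v⟩
  exists_edge_bag p q _ := ⟨0, Finset.mem_univ p, Finset.mem_univ q⟩
  connected_nodes v := by
    have : Nonempty {i : Fin 1 | v ∈ (Finset.univ : Finset V)} := ⟨⟨0, Finset.mem_univ v⟩⟩
    exact (SimpleGraph.IsTree.of_subsingleton).1

lemma card_le_treeWidth_add_one_of_isClique {V : Type*} [Fintype V] {G : SimpleGraph V}
    {K : Finset V} (hK : G.IsClique (K : Set V)) : K.card ≤ treeWidth G + 1 := by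
  -- the set of widths is nonempty, so that its infimum is attained
  obtain ⟨m, D, hD⟩ := Nat.sInf_mem
    (s := {w : ℕ | ∃ (m : ℕ) (D : TreeDecomposition G (Fin m)), D.width = w})
    ⟨_, 1, TreeDecomposition.trivial G, rfl⟩
  obtain ⟨i, hi⟩ := D.exists_bag_of_isClique hK
  have h1 := Finset.card_le_card hi
  have h2 := Finset.le_sup (f := fun i => (D.bag i).card) (Finset.mem_univ i)
  change _ ≤ sInf _ + 1
  rw [← hD, TreeDecomposition.width]
  omega

/-! ### Building graphs by multi-expressions -/

/-- Some allowed multi-`K`-expression builds the adjacency relation `A` on the vertex set `s`,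
with label sets `lab`. Relations and labelings are given on the ambient type `V` and matter only
on `s`. -/
def MultiBuilds {V : Type*} {K : ℕ} (s : Finset V) (A : V → V → Prop)
    (lab : V → Finset (Fin K)) : Prop :=
  ∃ e : MultiExpr K, e.Valid ∧ ∃ φ : e.Vert → V, Function.Injective φ ∧
    (∀ x, (∃ u, φ u = x) ↔ x ∈ s) ∧ (∀ u v, e.graph.Adj u v ↔ A (φ u) (φ v)) ∧
    ∀ v, e.labels v = lab (φ v)

namespace MultiBuilds

variable {V : Type*} {K : ℕ} {s : Finset V} {A A' : V → V → Prop} {lab lab' : V → Finset (Fin K)}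

lemma congr (h : MultiBuilds s A lab) (hA : ∀ u ∈ s, ∀ v ∈ s, (A u v ↔ A' u v))
    (hl : ∀ v ∈ s, lab v = lab' v) : MultiBuilds s A' lab' := by
  obtain ⟨e, he, φ, hφ, hs, hadj, hlab⟩ := h
  have hm : ∀ u, φ u ∈ s := fun u => (hs _).1 ⟨u, rfl⟩
  exact ⟨e, he, φ, hφ, hs, fun u v => (hadj u v).trans (hA _ (hm u) _ (hm v)),
    fun v => (hlab v).trans (hl _ (hm v))⟩

lemma singleton (v : V) (S : Finset (Fin K)) :
    MultiBuilds {v} (fun _ _ => False) (fun _ => S) := by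
  refine ⟨.atom 1 one_pos S, trivial, fun _ => v, ?_, ?_, ?_, fun _ => rfl⟩
  · intro (a : Fin 1) (b : Fin 1) _
    exact Subsingleton.elim a b
  · intro x
    rw [Finset.mem_singleton]
    exact ⟨fun ⟨_, h⟩ => h.symm, fun h => ⟨(0 : Fin 1), h.symm⟩⟩
  · exact fun _ _ => Iff.rfl

lemma insert [DecidableEq V] (h : MultiBuilds s A lab) {v : V} (hv : v ∉ s)
    (S : Finset (Fin K)) :
    MultiBuilds (insert v s) (fun u w => u ≠ v ∧ w ≠ v ∧ A u w)
      (fun u => if u = v then S else lab u) := by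
  obtain ⟨e, he, φ, hφ, hs, hadj, hlab⟩ := h
  have hne : ∀ u, φ u ≠ v := fun u hu => hv (hu ▸ (hs _).1 ⟨u, rfl⟩)
  refine ⟨.join e (.atom 1 one_pos S), ⟨he, trivial⟩,
    Sum.elim φ (fun _ : Fin 1 => v), ?_, ?_, ?_, ?_⟩
  · rintro (a | a) (b | b) hab
    · exact congrArg Sum.inl (hφ hab)
    · exact absurd hab (hne a)
    · exact absurd hab.symm (hne b)
    · exact congrArg Sum.inr (Subsingleton.elim (α := Fin 1) a b)
  · intro x
    rw [Finset.mem_insert, ← hs]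
    constructor
    · rintro ⟨a | a, rfl⟩
      · exact Or.inr ⟨a, rfl⟩
      · exact Or.inl rfl
    · rintro (rfl | ⟨a, rfl⟩)
      · exact ⟨Sum.inr (0 : Fin 1), rfl⟩
      · exact ⟨Sum.inl a, rfl⟩
  · rintro (a | a) (b | b)
    · exact (hadj a b).trans ⟨fun h => ⟨hne a, hne b, h⟩, fun h => h.2.2⟩
    · exact ⟨fun h => (nomatch h), fun h => absurd rfl h.2.1⟩
    · exact ⟨fun h => (nomatch h), fun h => absurd rfl h.1⟩
    · exact ⟨fun h => (nomatch h), fun h => absurd rfl h.1⟩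
  · rintro (a | a)
    · exact (hlab a).trans (if_neg (hne a)).symm
    · exact (if_pos rfl).symm

lemma eta (h : MultiBuilds s A lab) {i j : Fin K} (hij : i ≠ j)
    (hd : ∀ v ∈ s, ¬ (i ∈ lab v ∧ j ∈ lab v)) :
    MultiBuilds s (fun u w => A u w ∨
      (u ≠ w ∧ ((i ∈ lab u ∧ j ∈ lab w) ∨ (i ∈ lab w ∧ j ∈ lab u)))) lab := by
  obtain ⟨e, he, φ, hφ, hs, hadj, hlab⟩ := h
  refine ⟨.eta i j e, ⟨he, hij, fun v => ?_⟩, φ, hφ, hs, fun (u v : e.Vert) => ?_, hlab⟩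
  · rw [hlab]
    exact hd _ ((hs _).1 ⟨v, rfl⟩)
  · beta_reduce
    rw [← hadj, ← hlab, ← hlab, hφ.ne_iff]
    exact Iff.rfl

lemma rho (h : MultiBuilds s A lab) (i : Fin K) (S : Finset (Fin K)) :
    MultiBuilds s A (fun v => if i ∈ lab v then (lab v).erase i ∪ S else lab v) := by
  obtain ⟨e, he, φ, hφ, hs, hadj, hlab⟩ := h
  refine ⟨.rho i S e, he, φ, hφ, hs, hadj, fun (v : e.Vert) => ?_⟩
  beta_reduce
  rw [← hlab]
  rfl

/-- Join a fixed label `j` with every label in `I`. -/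
lemma eta_finset (h : MultiBuilds s A lab) (j : Fin K) (I : Finset (Fin K)) (hj : j ∉ I)
    (hd : ∀ v ∈ s, ∀ i ∈ I, ¬ (i ∈ lab v ∧ j ∈ lab v)) :
    MultiBuilds s (fun u w => A u w ∨
      (u ≠ w ∧ ((∃ i ∈ I, i ∈ lab u ∧ j ∈ lab w) ∨ (∃ i ∈ I, i ∈ lab w ∧ j ∈ lab u)))) lab := by
  induction I using Finset.induction_on with
  | empty => exact h.congr (by simp) (by simp)
  | insert a I ha ih =>
    rw [Finset.mem_insert, not_or] at hj
    have := (ih hj.2 fun v hv i hi => hd v hv i (Finset.mem_insert_of_mem hi)).eta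
      (Ne.symm hj.1) (fun v hv => hd v hv a (Finset.mem_insert_self a I))
    refine this.congr (fun u _ v _ => ?_) (fun _ _ => rfl)
    simp only [Finset.exists_mem_insert]
    rw [or_assoc, ← and_or_left, or_or_or_comm, or_comm (b := a ∈ lab u ∧ _),
      or_comm (b := a ∈ lab v ∧ _)]

end MultiBuilds

/-- Add the vertices in the order of increasing `rank`. A vertex keeps the label set `L v` once it
has been added, and on being added it is joined to the vertices having a label in `R v`. One
additional label marks the vertex that is being added. -/
lemma multiBuilds_of_rank {V : Type*} {K : ℕ} (G : SimpleGraph V) (rank : V → ℕ)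
    (L R : V → Finset (Fin K))
    (hG : ∀ u v, u ≠ v → rank u ≤ rank v → (G.Adj u v ↔ ∃ l, l ∈ L u ∧ l ∈ R v))
    (s : Finset V) (hs : s.Nonempty) :
    MultiBuilds s G.Adj (fun v => (L v).map Fin.castSuccEmb) := by
  classical
  induction s using Finset.induction_on_max_value rank with
  | empty => exact absurd hs Finset.not_nonempty_empty
  | insert v s hv hmax ih =>
    rcases s.eq_empty_or_nonempty with rfl | hne
    · exact (MultiBuilds.singleton v ((L v).map Fin.castSuccEmb)).congr (by simp) (by simp)
    have hlast : ∀ S : Finset (Fin K), Fin.last K ∉ S.map Fin.castSuccEmb := by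
      intro S h
      obtain ⟨l, _, hl⟩ := Finset.mem_map.1 h
      exact (Fin.castSucc_lt_last l).ne hl
    have h1 := ((ih hne).insert hv {Fin.last K}).eta_finset (Fin.last K)
      ((R v).map Fin.castSuccEmb) (hlast _) ?_
    · refine (h1.rho (Fin.last K) ((L v).map Fin.castSuccEmb)).congr ?_ ?_
      · -- the new vertex and an old vertex
        have key : ∀ u ∈ s, (G.Adj u v ↔
            ∃ i ∈ (R v).map Fin.castSuccEmb, i ∈ (L u).map Fin.castSuccEmb) := by
          intro u hu
          rw [hG u v (by rintro rfl; exact hv hu) (hmax u hu)]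
          simp [and_comm]
        intro u hu' w hw'
        rcases Finset.mem_insert.1 hu' with rfl | hu <;>
          rcases Finset.mem_insert.1 hw' with rfl | hw
        · simp
        · have hwv : w ≠ u := by rintro rfl; exact hv hw
          rw [G.adj_comm, key w hw]
          simp [hwv, hwv.symm, hlast]
        · have huv : u ≠ w := by rintro rfl; exact hv hu
          rw [key u hu]
          simp [huv, hlast]
        · have hwv : w ≠ v := by rintro rfl; exact hv hw
          have huv : u ≠ v := by rintro rfl; exact hv hu
          simp [hwv, huv, hlast]
      · intro u hu
        by_cases huv : u = v <;> simp [huv, hlast]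
    · rintro u - i hi ⟨h2, h3⟩
      by_cases huv : u = v
      · simp only [huv, if_true, Finset.mem_singleton] at h2
        exact hlast _ (h2 ▸ hi)
      · simp only [huv, if_false] at h3
        exact hlast _ h3

lemma multiCliqueWidth_le_of_rank {V : Type*} [Fintype V] [Nonempty V] {K : ℕ}
    (G : SimpleGraph V) (rank : V → ℕ) (L R : V → Finset (Fin K))
    (hG : ∀ u v, u ≠ v → rank u ≤ rank v → (G.Adj u v ↔ ∃ l, l ∈ L u ∧ l ∈ R v)) :
    multiCliqueWidth G ≤ K + 1 := by
  obtain ⟨e, he, φ, hφ, hs, hadj, -⟩ :=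
    multiBuilds_of_rank G rank L R hG Finset.univ Finset.univ_nonempty
  exact Nat.sInf_le ⟨e, he, ⟨⟨Equiv.ofBijective φ ⟨hφ, fun x => (hs x).2 (Finset.mem_univ x)⟩,
    fun {u v} => (hadj u v).symm⟩⟩⟩

/-! ### Clique-width: every graph has an expression -/

/-- Some `k`-expression builds the adjacency relation `A` on the vertex set `s`, with labels
`lab`. Relations and labelings are given on the ambient type `V` and matter only on `s`. -/
def CWBuilds {V : Type*} {k : ℕ} (s : Finset V) (A : V → V → Prop) (lab : V → Fin k) : Prop :=
  ∃ e : CWExpr k, ∃ φ : e.Vert → V, Function.Injective φ ∧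
    (∀ x, (∃ u, φ u = x) ↔ x ∈ s) ∧ (∀ u v, e.graph.Adj u v ↔ A (φ u) (φ v)) ∧
    ∀ v, e.label v = lab (φ v)

namespace CWBuilds

variable {V : Type*} {k : ℕ} {s : Finset V} {A A' : V → V → Prop} {lab : V → Fin k}

lemma congr (h : CWBuilds s A lab) (hA : ∀ u v, A u v ↔ A' u v) : CWBuilds s A' lab := by
  have : A = A' := by
    ext u v
    exact hA u v
  exact this ▸ h

lemma edgeless [DecidableEq V] (hs : s.Nonempty) (lab : V → Fin k) :
    CWBuilds s (fun _ _ => False) lab := by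
  induction hs using Finset.Nonempty.cons_induction with
  | singleton v =>
    refine ⟨.vertex (lab v), fun _ => v, ?_, ?_, fun _ _ => Iff.rfl, fun _ => rfl⟩
    · intro (a : Unit) (b : Unit) _
      rfl
    · intro x
      rw [Finset.mem_singleton]
      exact ⟨fun ⟨_, h⟩ => h.symm, fun h => ⟨(), h.symm⟩⟩
  | cons v s hv hs ih =>
    obtain ⟨e, φ, hφ, hs, hadj, hlab⟩ := ih
    have hne : ∀ u, φ u ≠ v := fun u hu => hv (hu ▸ (hs _).1 ⟨u, rfl⟩)
    refine ⟨.join e (.vertex (lab v)), Sum.elim φ (fun _ : Unit => v), ?_, ?_, ?_, ?_⟩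
    · rintro (a | a) (b | b) hab
      · exact congrArg Sum.inl (hφ hab)
      · exact absurd hab (hne a)
      · exact absurd hab.symm (hne b)
      · exact congrArg Sum.inr (Subsingleton.elim (α := Unit) a b)
    · intro x
      rw [Finset.mem_cons, ← hs]
      constructor
      · rintro ⟨a | a, rfl⟩
        · exact Or.inr ⟨a, rfl⟩
        · exact Or.inl rfl
      · rintro (rfl | ⟨a, rfl⟩)
        · exact ⟨Sum.inr (), rfl⟩
        · exact ⟨Sum.inl a, rfl⟩
    · rintro (a | a) (b | b)
      · exact hadj a b
      · exact ⟨fun h => (nomatch h), False.elim⟩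
      · exact ⟨fun h => (nomatch h), False.elim⟩
      · exact ⟨fun h => (nomatch h), False.elim⟩
    · rintro (a | a)
      · exact hlab a
      · rfl

lemma eta (h : CWBuilds s A lab) {i j : Fin k} (hij : i ≠ j) :
    CWBuilds s (fun u w => A u w ∨
      (u ≠ w ∧ ((lab u = i ∧ lab w = j) ∨ (lab w = i ∧ lab u = j)))) lab := by
  obtain ⟨e, φ, hφ, hs, hadj, hlab⟩ := h
  refine ⟨.eta i j hij e, φ, hφ, hs, fun (u v : e.Vert) => ?_, hlab⟩
  beta_reduce
  rw [← hadj, ← hlab, ← hlab, hφ.ne_iff]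
  exact Iff.rfl

end CWBuilds

/-- With one label for each vertex, the edges can be added one by one. -/
lemma exists_cwExpr {n : ℕ} [NeZero n] (G : SimpleGraph (Fin n)) :
    ∃ e : CWExpr n, Nonempty (e.graph ≃g G) := by
  classical
  have key : ∀ E : Finset (Fin n × Fin n), CWBuilds Finset.univ
      (fun u v => u ≠ v ∧ ((u, v) ∈ E ∨ (v, u) ∈ E)) (id : Fin n → Fin n) := by
    intro E
    induction E using Finset.induction_on with
    | empty => exact (CWBuilds.edgeless Finset.univ_nonempty _).congr (by simp)
    | insert p E hp ih =>
      obtain ⟨i, j⟩ := p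
      by_cases hij : i = j
      · subst hij
        refine ih.congr fun u v => ?_
        simp only [Finset.mem_insert, Prod.mk.injEq]
        grind
      · refine (ih.eta hij).congr fun u v => ?_
        simp only [Finset.mem_insert, Prod.mk.injEq, id]
        grind
  obtain ⟨e, φ, hφ, hs, hadj, -⟩ := key (Finset.univ.filter fun p => G.Adj p.1 p.2)
  refine ⟨e, ⟨⟨Equiv.ofBijective φ ⟨hφ, fun x => (hs x).2 (Finset.mem_univ x)⟩, ?_⟩⟩⟩
  intro u v
  refine Iff.trans ?_ (hadj u v).symm
  simp only [Finset.mem_filter, Finset.mem_univ, true_and, G.adj_comm (φ v), or_self]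
  exact ⟨fun h => ⟨h.ne, h⟩, fun h => h.2⟩

lemma le_cliqueWidth {n b : ℕ} [NeZero n] {G : SimpleGraph (Fin n)}
    (h : ∀ k, ∀ e : CWExpr k, (e.graph ≃g G) → b ≤ k) : b ≤ cliqueWidth G := by
  obtain ⟨e, he⟩ := exists_cwExpr G
  refine le_csInf ⟨n, e, he⟩ ?_
  rintro k ⟨e, ⟨f⟩⟩
  exact h k e f

/-! ### Clique-width: cuts with few neighborhoods -/

/-- With respect to `G`, the vertices in `A` have at most `k` different neighborhoods outside
`A`. -/
def FewOuterNeighborhoods {V : Type*} (G : SimpleGraph V) (k : ℕ) (A : Set V) : Prop :=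
  ∃ ℓ : V → Fin k, ∀ u ∈ A, ∀ v ∈ A, ℓ u = ℓ v → ∀ w ∉ A, (G.Adj u w ↔ G.Adj v w)

/-- The expression `e` occurs, by means of the injection `φ`, inside an expression that builds
`G`: what is added later to the graph of `e` depends only on the labels. -/
structure CWExpr.Occurs {V : Type*} {k : ℕ} (G : SimpleGraph V) (e : CWExpr k)
    (φ : e.Vert → V) : Prop where
  injective : Function.Injective φ
  adj_inside : ∃ P : Fin k → Fin k → Prop, ∀ u v, u ≠ v →
    (G.Adj (φ u) (φ v) ↔ e.graph.Adj u v ∨ P (e.label u) (e.label v))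
  adj_outside : ∀ u v, e.label u = e.label v → ∀ w ∉ Set.range φ,
    (G.Adj (φ u) w ↔ G.Adj (φ v) w)

namespace CWExpr.Occurs

variable {V : Type*} {k : ℕ} {G : SimpleGraph V}

lemma fewOuterNeighborhoods [Nonempty (Fin k)] {e : CWExpr k} {φ : e.Vert → V}
    (h : e.Occurs G φ) : FewOuterNeighborhoods G k (Set.range φ) := by
  classical
  refine ⟨fun v => if hv : ∃ u, φ u = v then e.label hv.choose else Classical.arbitrary _, ?_⟩
  rintro _ ⟨u, rfl⟩ _ ⟨v, rfl⟩ huv w hw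
  have hu : ∃ x, φ x = φ u := ⟨u, rfl⟩
  have hv : ∃ x, φ x = φ v := ⟨v, rfl⟩
  simp only [hu, hv, dif_pos] at huv
  have h1 := h.adj_outside _ _ huv w hw
  rwa [hu.choose_spec, hv.choose_spec] at h1

lemma of_iso {e : CWExpr k} (f : e.graph ≃g G) : e.Occurs G f where
  injective := f.injective
  adj_inside := ⟨fun _ _ => False, fun u v _ => by rw [f.map_adj_iff, or_false]⟩
  adj_outside _ _ _ w hw := absurd (f.surjective w) hw

lemma of_eta {e : CWExpr k} {i j : Fin k} {hij : i ≠ j} {φ : e.Vert → V}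
    (h : (eta i j hij e).Occurs G φ) : e.Occurs G φ := by
  obtain ⟨h1, ⟨P, h2⟩, h3⟩ := h
  refine ⟨h1, ⟨fun a b => (a = i ∧ b = j ∨ b = i ∧ a = j) ∨ P a b, fun u v huv => ?_⟩, h3⟩
  refine (h2 u v huv).trans ?_
  rw [← or_assoc]
  refine or_congr (or_congr Iff.rfl ?_) Iff.rfl
  exact ⟨fun h => h.2, fun h => ⟨huv, h⟩⟩

lemma of_rho {e : CWExpr k} {i j : Fin k} {φ : e.Vert → V}
    (h : (rho i j e).Occurs G φ) : e.Occurs G φ := by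
  obtain ⟨h1, ⟨P, h2⟩, h3⟩ := h
  refine ⟨h1, ⟨fun a b => P (if a = i then j else a) (if b = i then j else b), h2⟩,
    fun u v huv => h3 u v ?_⟩
  change (if e.label u = i then j else e.label u) = if e.label v = i then j else e.label v
  rw [huv]

lemma of_join_left {a b : CWExpr k} {φ : (join a b).Vert → V}
    (h : (join a b).Occurs G φ) : a.Occurs G (fun u => φ (Sum.inl u)) := by
  obtain ⟨h1, ⟨P, h2⟩, h3⟩ := h
  refine ⟨fun u v huv => Sum.inl_injective (h1 huv), ⟨P, fun u v huv => ?_⟩, ?_⟩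
  · exact h2 (Sum.inl u) (Sum.inl v) (Sum.inl_injective.ne huv)
  · intro u v huv w hw
    by_cases hw' : w ∈ Set.range φ
    · obtain ⟨x | x, rfl⟩ := hw'
      · exact absurd ⟨x, rfl⟩ hw
      · have key : ∀ y, (G.Adj (φ (Sum.inl y)) (φ (Sum.inr x)) ↔ P (a.label y) (b.label x)) :=
          fun y => (h2 (Sum.inl y) (Sum.inr x) Sum.inl_ne_inr).trans
            ⟨fun h => h.resolve_left (fun h => nomatch h), Or.inr⟩
        rw [key, key, huv]
    · exact h3 (Sum.inl u) (Sum.inl v) huv w hw'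

lemma of_join_right {a b : CWExpr k} {φ : (join a b).Vert → V}
    (h : (join a b).Occurs G φ) : b.Occurs G (fun u => φ (Sum.inr u)) := by
  obtain ⟨h1, ⟨P, h2⟩, h3⟩ := h
  refine ⟨fun u v huv => Sum.inr_injective (h1 huv), ⟨P, fun u v huv => ?_⟩, ?_⟩
  · exact h2 (Sum.inr u) (Sum.inr v) (Sum.inr_injective.ne huv)
  · intro u v huv w hw
    by_cases hw' : w ∈ Set.range φ
    · obtain ⟨x | x, rfl⟩ := hw'
      · have key : ∀ y, (G.Adj (φ (Sum.inr y)) (φ (Sum.inl x)) ↔ P (b.label y) (a.label x)) :=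
          fun y => (h2 (Sum.inr y) (Sum.inl x) Sum.inr_ne_inl).trans
            ⟨fun h => h.resolve_left (fun h => nomatch h), Or.inr⟩
        rw [key, key, huv]
      · exact absurd ⟨x, rfl⟩ hw
    · exact h3 (Sum.inr u) (Sum.inr v) huv w hw'

/-- A minimal subexpression whose vertex set is big is a disjoint union of two that are not. -/
lemma exists_cut [Nonempty (Fin k)] {Big : Set V → Prop} (hone : ∀ v, ¬ Big {v}) (e : CWExpr k)
    (φ : e.Vert → V) (h : e.Occurs G φ) (hbig : Big (Set.range φ)) :
    ∃ A B : Set V, FewOuterNeighborhoods G k A ∧ FewOuterNeighborhoods G k B ∧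
      ¬ Big A ∧ ¬ Big B ∧ Big (A ∪ B) := by
  induction e with
  | vertex i =>
    refine absurd hbig ?_
    have : Set.range φ = {φ ()} := Set.range_unique (ι := Unit) (f := φ)
    rw [this]
    exact hone _
  | eta i j hij e ih => exact ih φ h.of_eta hbig
  | rho i j e ih => exact ih φ h.of_rho hbig
  | join a b iha ihb =>
    by_cases ha : Big (Set.range fun u => φ (Sum.inl u))
    · exact iha _ h.of_join_left ha
    by_cases hb : Big (Set.range fun u => φ (Sum.inr u))
    · exact ihb _ h.of_join_right hb
    refine ⟨_, _, h.of_join_left.fewOuterNeighborhoods, h.of_join_right.fewOuterNeighborhoods,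
      ha, hb, ?_⟩
    convert hbig
    ext x
    constructor
    · rintro (⟨u, rfl⟩ | ⟨u, rfl⟩)
      · exact ⟨Sum.inl u, rfl⟩
      · exact ⟨Sum.inr u, rfl⟩
    · rintro ⟨u | u, rfl⟩
      · exact Or.inl ⟨u, rfl⟩
      · exact Or.inr ⟨u, rfl⟩

end CWExpr.Occurs

/-! ### Hub graphs -/

/-- The graph in which a vertex `v` carries a hub `(p v).1` and a set of hubs `(p v).2`, and two
distinct vertices are adjacent if the hub of one of them belongs to the set of the other. -/
def hubGraph {V H : Type*} (p : V → H × Finset H) : SimpleGraph V :=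
  SimpleGraph.fromRel fun u v => (p v).1 ∈ (p u).2

lemma hubGraph_adj {V H : Type*} {p : V → H × Finset H} {u v : V} :
    (hubGraph p).Adj u v ↔ u ≠ v ∧ ((p v).1 ∈ (p u).2 ∨ (p u).1 ∈ (p v).2) :=
  Iff.rfl

/-- Two labels for every hub let a new vertex find the old vertices whose set contains the new hub
and the old vertices whose hub belongs to the new set. The second kind of label is not needed for
the hub `0`: the vertices with that hub come last, and among these the ones with `0` in their set
come first. -/
lemma multiCliqueWidth_hubGraph_le {V : Type*} [Fintype V] [Nonempty V] {m : ℕ}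
    (p : V → Fin (m + 1) × Finset (Fin (m + 1))) :
    multiCliqueWidth (hubGraph p) ≤ 2 * m + 2 := by
  classical
  have key : multiCliqueWidth (hubGraph p) ≤ (m + 1 + m) + 1 := by
    let rank : V → ℕ := fun v => if (p v).1 ≠ 0 then 0 else if 0 ∈ (p v).2 then 1 else 2
    let L : V → Finset (Fin (m + 1) ⊕ Fin m) := fun v =>
      Finset.univ.filter fun l => Sum.elim (fun a => a ∈ (p v).2) (fun b => (p v).1 = b.succ) l
    let R : V → Finset (Fin (m + 1) ⊕ Fin m) := fun v =>
      Finset.univ.filter fun l => Sum.elim (fun a => (p v).1 = a) (fun b => b.succ ∈ (p v).2) l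
    refine multiCliqueWidth_le_of_rank (hubGraph p) rank
      (fun v => (L v).map finSumFinEquiv.toEmbedding)
      (fun v => (R v).map finSumFinEquiv.toEmbedding) fun u v huv hr => ?_
    have hlab : (∃ l, l ∈ (L u).map finSumFinEquiv.toEmbedding ∧
        l ∈ (R v).map finSumFinEquiv.toEmbedding) ↔
        ((p v).1 ∈ (p u).2 ∨ ((p u).1 ≠ 0 ∧ (p u).1 ∈ (p v).2)) := by
      rw [finSumFinEquiv.surjective.exists]
      simp only [Finset.mem_map_equiv, Equiv.symm_apply_apply, Sum.exists, L, R,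
        Finset.mem_filter, Finset.mem_univ, true_and, Sum.elim_inl, Sum.elim_inr,
        exists_eq_right']
      refine or_congr Iff.rfl ⟨?_, ?_⟩
      · rintro ⟨b, hb, hb'⟩
        exact ⟨hb ▸ b.succ_ne_zero, hb ▸ hb'⟩
      · rintro ⟨h0, h⟩
        obtain ⟨b, hb⟩ := Fin.exists_succ_eq.2 h0
        exact ⟨b, hb.symm, hb ▸ h⟩
    rw [hlab, hubGraph_adj]
    simp only [huv, ne_eq, not_false_eq_true, true_and]
    refine ⟨?_, fun h => h.imp id And.right⟩
    rintro (h | h)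
    · exact Or.inl h
    by_cases hu : (p u).1 = 0
    · -- by the order of the vertices, both hubs are `0` and both sets contain `0`
      rw [hu] at h
      simp only [rank, hu, h] at hr
      left
      by_cases hv : (p v).1 = 0 <;> by_cases hu' : 0 ∈ (p u).2 <;> simp_all
    · exact Or.inr ⟨hu, h⟩
  omega

/-- A set of vertices is rich if, for some hub `i`, it contains vertices with hub `i` for at least
half of all sets of hubs. The vertex with hub `i` and set `S` is chosen to be `s (i, S)`. -/
def IsRich {V : Type*} {m : ℕ} (s : Fin (m + 1) × Finset (Fin (m + 1)) → V) (A : Set V) : Prop :=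
  ∃ i, 2 ^ m ≤ {S | s (i, S) ∈ A}.ncard

/-- For every hub `j`, a set `A` that is not rich misses some vertex with hub `j` whose set avoids
the given hub `i`. Such a vertex is adjacent to `s (i, S)` exactly if `j ∈ S`. -/
lemma ncard_le_of_not_isRich {V : Type*} {m k : ℕ} {p : V → Fin (m + 1) × Finset (Fin (m + 1))}
    {s : Fin (m + 1) × Finset (Fin (m + 1)) → V} (hs : Function.RightInverse s p) {A : Set V}
    (hfew : FewOuterNeighborhoods (hubGraph p) k A) (hA : ¬ IsRich s A) (i : Fin (m + 1)) :
    {S | s (i, S) ∈ A}.ncard ≤ k := by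
  classical
  obtain ⟨ℓ, hℓ⟩ := hfew
  have hwit : ∀ j, ∃ T, i ∉ T ∧ s (j, T) ∉ A := by
    intro j
    by_contra! hcon
    refine hA ⟨j, ?_⟩
    have hsub : (((Finset.univ.erase i).powerset : Finset (Finset (Fin (m + 1)))) :
        Set (Finset (Fin (m + 1)))) ⊆ {T | s (j, T) ∈ A} := by
      intro T hT
      refine hcon T fun hiT => ?_
      exact Finset.notMem_erase i Finset.univ (Finset.mem_powerset.1 (Finset.mem_coe.1 hT) hiT)
    have h1 := Set.ncard_le_ncard hsub (Set.toFinite _)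
    rw [Set.ncard_coe_finset, Finset.card_powerset,
      Finset.card_erase_of_mem (Finset.mem_univ i)] at h1
    simpa using h1
  have hinj : Set.InjOn (fun S => ℓ (s (i, S))) {S | s (i, S) ∈ A} := by
    intro S hS S' hS' heq
    ext j
    obtain ⟨T, hiT, hT⟩ := hwit j
    have hadj : ∀ S, s (i, S) ∈ A → ((hubGraph p).Adj (s (i, S)) (s (j, T)) ↔ j ∈ S) := by
      intro S hS
      rw [hubGraph_adj, hs, hs]
      simp only [hiT, or_false, and_iff_right_iff_imp]
      exact fun _ h => hT (h ▸ hS)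
    rw [← hadj S hS, ← hadj S' hS']
    exact hℓ _ hS _ hS' heq _ hT
  have h2 := Set.ncard_le_ncard_of_injOn (t := Set.univ) _ (fun _ _ => Set.mem_univ _) hinj
    Set.finite_univ
  simpa [Set.ncard_univ] using h2

/-- A minimal rich subexpression splits into two that are not rich, and one of these contains a
quarter of all sets of hubs, for a suitable hub `i`. -/
lemma two_pow_le_of_iso_hubGraph {V : Type*} {m k : ℕ}
    {p : V → Fin (m + 2) × Finset (Fin (m + 2))}
    {s : Fin (m + 2) × Finset (Fin (m + 2)) → V} (hs : Function.RightInverse s p)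
    (e : CWExpr k) (f : e.graph ≃g hubGraph p) : 2 ^ m ≤ k := by
  have : Nonempty (Fin k) := ⟨e.label (f.symm (s (0, ∅)))⟩
  have hone : ∀ v, ¬ IsRich s {v} := by
    rintro v ⟨i, hi⟩
    have h1 : {S | s (i, S) ∈ ({v} : Set V)}.ncard ≤ 1 := by
      rw [Set.ncard_le_one (Set.toFinite _)]
      intro S hS S' hS'
      exact (Prod.mk.inj (hs.injective ((show s (i, S) = v from hS).trans
        (show s (i, S') = v from hS').symm))).2
    have h2 : 2 ^ (m + 1) = 2 * 2 ^ m := by ring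
    have h3 : 0 < 2 ^ m := by positivity
    have h4 : 2 ^ (m + 1) ≤ 1 := hi.trans h1
    omega
  have hbig : IsRich s (Set.range f) := by
    refine ⟨0, ?_⟩
    have h1 : {S | s (0, S) ∈ Set.range f} = Set.univ :=
      Set.eq_univ_of_forall fun S => f.surjective _
    rw [h1, Set.ncard_univ, Nat.card_eq_fintype_card, Fintype.card_finset, Fintype.card_fin]
    exact Nat.pow_le_pow_right two_pos (Nat.le_succ _)
  obtain ⟨A, B, hfA, hfB, hA, hB, i, hi⟩ :=
    CWExpr.Occurs.exists_cut hone e f (.of_iso f) hbig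
  have h1 := ncard_le_of_not_isRich hs hfA hA i
  have h2 := ncard_le_of_not_isRich hs hfB hB i
  have h3 : {S | s (i, S) ∈ A ∪ B}.ncard ≤
      {S | s (i, S) ∈ A}.ncard + {S | s (i, S) ∈ B}.ncard := by
    exact Set.ncard_union_le _ _
  have h4 : 2 ^ (m + 1) ≤ k + k := (hi.trans h3).trans (add_le_add h1 h2)
  have h5 : 2 ^ (m + 1) = 2 * 2 ^ m := by ring
  omega

theorem corollary3p7 :
    ∃ c : ℝ, 0 < c ∧
      ∀ k : ℕ, ∃ N : ℕ, ∀ n : ℕ, N ≤ n →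
        ∃ G : SimpleGraph (Fin n),
          c * (n : ℝ) ≤ (treeWidth G : ℝ) ∧
          multiCliqueWidth G ≤ k + 2 ∧
          (2 : ℝ) ^ (((k / 2 : ℕ) : ℤ) - 1) ≤ (cliqueWidth G : ℝ) := by
  refine ⟨1 / 2, by norm_num, fun k => ?_⟩
  obtain ⟨m, hm⟩ : ∃ m, m = k / 2 := ⟨_, rfl⟩
  rw [← hm]
  let X := Fin (m + 1) × Finset (Fin (m + 1))
  refine ⟨2 * Fintype.card X + 2, fun n hn => ?_⟩
  have : NeZero n := ⟨by omega⟩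
  -- the first vertices run over all pairs, all the others have the pair `(0, {0})`
  let E := Fintype.equivFin X
  let p : Fin n → X := fun v =>
    if h : (v : ℕ) < Fintype.card X then E.symm ⟨v, h⟩ else (0, {0})
  let s : X → Fin n := fun x => Fin.castLE (by omega) (E x)
  have hs : Function.RightInverse s p := by
    intro x
    have h : ((s x : Fin n) : ℕ) < Fintype.card X := (E x).2
    simp only [p, h, dif_pos]
    exact E.symm_apply_apply x
  refine ⟨hubGraph p, ?_, ?_, ?_⟩
  · let K : Finset (Fin n) := Finset.Ici ⟨Fintype.card X, by omega⟩
    have hp : ∀ v ∈ K, p v = (0, {0}) := by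
      intro v hv
      have hv' : Fintype.card X ≤ v := Fin.le_def.1 (Finset.mem_Ici.1 hv)
      simp only [p, hv'.not_gt, dif_neg, not_false_eq_true]
    have hK : (hubGraph p).IsClique (K : Set (Fin n)) := by
      intro u hu v hv huv
      rw [hubGraph_adj, hp u hu, hp v hv]
      exact ⟨huv, Or.inl (Finset.mem_singleton_self 0)⟩
    have h1 := card_le_treeWidth_add_one_of_isClique hK
    have hcard : K.card = n - Fintype.card X := Fin.card_Ici _
    have h2 : n ≤ 2 * treeWidth (hubGraph p) := by omega
    have h3 : (n : ℝ) ≤ 2 * (treeWidth (hubGraph p) : ℝ) := by exact_mod_cast h2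
    linarith
  · have := multiCliqueWidth_hubGraph_le p
    omega
  · rcases m with _ | m
    · have h1 : 1 ≤ cliqueWidth (hubGraph p) :=
        le_cliqueWidth fun k e f => Fin.pos (e.label (f.symm 0))
      have h2 : (1 : ℝ) ≤ cliqueWidth (hubGraph p) := by exact_mod_cast h1
      norm_num
      linarith
    · have h1 : 2 ^ m ≤ cliqueWidth (hubGraph p) :=
        le_cliqueWidth fun k e f => two_pow_le_of_iso_hubGraph hs e f
      have h2 : (((m + 1 : ℕ) : ℤ) - 1) = (m : ℤ) := by push_cast; ring
      rw [h2, zpow_natCast]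
      exact_mod_cast h1
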